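/- Let $\mathbb U$ be the open unit disc in $\mathbb C$, and for $D\subseteq\mathbb C$ let $\mathrm{rad}(D)=\sup\{R\ge 0 : R\cdot\mathbb U\subseteq D\}$. For a simply connected domain $D\subsetneq\mathbb C$ with $0\in D$ let $\varphi_D:D\to\mathbb U$ be the unique conformal map of $D$ onto $\mathbb U$ with $\varphi_D(0)=0$ and $\varphi_D'(0)>0$. Fix a bounded domain $\mathbf D\subset\mathbb C$ with $\mathrm{rad}(\mathbf D)>1/2$, and let $\mathfrak D$ be the set of all simply connected domains $D\subseteq\mathbf D$ with $\mathrm{rad}(D)>1/2$. For all $\varepsilon,\eta>0$ there exist $\delta_0>0$ and a finite family $\mathfrak D_{\varepsilon,\eta}$ of simply connected domains that contain $0$ and are contained in $\mathbf D$, such that for each $\tilde D\in\mathfrak D_{\varepsilon,\eta}$ the inverse $\varphi_{\tilde D}^{-1}$ extends continuously to the closed unit disc (the extension is still denoted $\varphi_{\tilde D}^{-1}$), and such that for every $D\in\mathfrak D$ there is $\tilde D\in\mathfrak D_{\varepsilon,\eta}$ with the following properties. 1. $\tilde D\subset D$, and moreover $\overline{\tilde D}\subset D$. 2. For every $a\in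 D$ with $|\varphi_D(a)|\le 1-\varepsilon$, we have $a\in\tilde D$ and $|\varphi_{\tilde D}(a)|\le 1-\varepsilon/2$. 3. For every $\xi\in\partial\tilde D$, we have $|\varphi_D(\xi)|\ge 1-\eta$. 4. For every $\xi\in\mathbb C$ with $|\xi|\le 1$, we have $\varphi_{\tilde D}^{-1}(\xi)\in D$ and $|\varphi_D(\varphi_{\tilde D}^{-1}(\xi))-\xi|\le\eta$. 5. For all $\xi\in\mathbb C$ and $z\in\overline{\tilde D}$ with $|z-\xi|\le\delta_0$, we have $\xi\in D$ and $|\varphi_D(\xi)-\varphi_D(z)|\le\eta$. -/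

import Mathlib

open Metric Set
open scoped Pointwise

noncomputable section

/-- A domain in the complex plane: a nonempty connected open set. -/
def IsPlaneDomain (D : Set ℂ) : Prop := IsOpen D ∧ IsConnected D

/-- The inner radius `sup {R ≥ 0 : R • 𝕌 ⊆ D}` of a set `D`, with `𝕌` the open unit disc. -/
def innerRadius (D : Set ℂ) : ℝ := sSup {R : ℝ | 0 ≤ R ∧ R • ball (0 : ℂ) 1 ⊆ D}

/-- The simply connected subdomains of `B` whose inner radius is larger than `1 / 2`. -/
def domainClass (B : Set ℂ) : Set (Set ℂ) :=
  {D | D ⊆ B ∧ IsPlaneDomain D ∧ IsSimplyConnected D ∧ 1 / 2 < innerRadius D}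

/-- `φ` is a conformal map (a holomorphic bijection) of `D` onto the open unit disc with
`φ 0 = 0` and `φ' 0 > 0`. -/
structure IsNormalizedConformal (D : Set ℂ) (φ : ℂ → ℂ) : Prop where
  differentiableOn : DifferentiableOn ℂ φ D
  bijOn : BijOn φ D (ball 0 1)
  map_zero : φ 0 = 0
  deriv_im : (deriv φ 0).im = 0
  deriv_re : 0 < (deriv φ 0).re

/-- The conformal map `φ_D` of a simply connected domain `D ≠ ℂ` with `0 ∈ D` onto the unit disc,
with `φ_D 0 = 0` and `φ_D' 0 > 0`. It is unique on `D`; values outside `D` have no meaning. -/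
def conformalMap (D : Set ℂ) : ℂ → ℂ := Classical.epsilon (IsNormalizedConformal D)

/-- The inverse `φ_D⁻¹`, on the open unit disc the inverse map into `D`, and at a point of the unit
circle the limit of `φ_D⁻¹` from inside the disc (meaningful where this limit exists). -/
def conformalInv (D : Set ℂ) : ℂ → ℂ :=
  extendFrom (ball (0 : ℂ) 1) (Function.invFunOn (conformalMap D) D)

end

/-!
The proof rests on compactness. Every `D` in the class contains the disc of radius `1 / 2` and is
contained in the bounded set `B`, so the inverse maps `f_D = φ_D⁻¹` form a uniformly bounded family
of univalent functions on the unit disc with `f_D' 0 ≥ 1 / 2`. For such a family: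

* Montel's theorem (`exists_tendstoLocallyUniformlyOn_of_bounded`) gives total boundedness for
  uniform convergence on compact sets (`exists_finite_net_of_bounded`);
* Hurwitz's theorem (`exists_eventually_ball_subset_image`) and compactness give a uniform covering
  property (`exists_uniform_ball_subset_image`): for given `ρ < 1` and `κ > 0` there is `τ > 0` such
  that `f_D` maps the `κ`-neighbourhood of each `w` with `|w| ≤ ρ` onto a set containing the disc of
  radius `τ` around `f_D w`.

Let `ρ = 1 - κ` with `κ` small, and choose finitely many members `E` of the class whose maps `f_E`
form a `τ / 2`-net for uniform convergence on `|w| ≤ ρ`. The finite family consists of the domains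
`f_E (ρ 𝕌)`. If `f_E` is the map of the net close to `f_D`, then `f_E w` lies within `τ` of `f_D w`,
so the covering property of `f_D` shows that `f_E w ∈ D` and `|φ_D (f_E w) - w| < κ`, and that this
persists under perturbations of size `τ / 2`. The covering property of `f_E` gives the inclusion in
the opposite direction. The conformal map of `f_E (ρ 𝕌)` is `φ_E / ρ`, by uniqueness in the Schwarz
lemma, so that its inverse `ξ ↦ f_E (ρ ξ)` extends continuously to the closed disc.

That `φ_D` exists is the Riemann mapping theorem (`exists_isNormalizedConformal`), proved here for
bounded domains by Koebe's extremal argument from the same theorems of Montel and Hurwitz. In all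
compactness arguments ultrafilter limits take the place of subsequences.
-/

open Filter Function
open scoped Topology

/-! ### Montel's theorem -/

/-- A form of **Montel's theorem**: along an ultrafilter, every uniformly bounded family of
holomorphic functions converges locally uniformly. Pointwise limits exist because closed balls are
compact, and the Schwarz lemma makes the family equicontinuous. -/
theorem exists_tendstoLocallyUniformlyOn_of_bounded {ι : Type*} (l : Ultrafilter ι) {U : Set ℂ}
    (hU : IsOpen U) {F : ι → ℂ → ℂ} {M : ℝ} (hF : ∀ i, DifferentiableOn ℂ (F i) U)
    (hM : ∀ i, ∀ z ∈ U, ‖F i z‖ ≤ M) :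
    ∃ f : ℂ → ℂ, TendstoLocallyUniformlyOn F f l U := by
  have hlim : ∀ z, ∃ y, z ∈ U → Tendsto (fun i ↦ F i z) l (𝓝 y) := by
    intro z
    by_cases hz : z ∈ U
    · obtain ⟨y, -, hy⟩ := (isCompact_closedBall (0 : ℂ) M).ultrafilter_le_nhds
        (l.map fun i ↦ F i z) (by
          rw [Ultrafilter.coe_map, le_principal_iff, mem_map]
          exact univ_mem' fun i ↦ by simpa using hM i z hz)
      exact ⟨y, fun _ ↦ hy⟩
    · exact ⟨0, fun h ↦ absurd h hz⟩
  choose f hf using hlim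
  refine ⟨f, Metric.tendstoLocallyUniformlyOn_iff.2 fun ε hε z hz ↦ ?_⟩
  obtain ⟨R, hR, hRU⟩ := Metric.isOpen_iff.1 hU z hz
  set C := 2 * M / R
  have hlip : ∀ i, ∀ y ∈ ball z R, dist (F i y) (F i z) ≤ C * dist y z := fun i y hy ↦
    Complex.dist_le_div_mul_dist_of_mapsTo_ball ((hF i).mono hRU) (fun w hw ↦ by
      rw [mem_closedBall, dist_eq_norm]
      linarith [norm_sub_le (F i w) (F i z), hM i w (hRU hw), hM i z hz]) hy
  have hC : ∀ᶠ y in 𝓝 z, C * dist y z < ε / 3 := by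
    have : Tendsto (fun y ↦ C * dist y z) (𝓝 z) (𝓝 (C * dist z z)) :=
      Continuous.tendsto (by fun_prop) z
    exact this.eventually_lt_const (by simpa using by positivity)
  refine ⟨_, mem_nhdsWithin_of_mem_nhds (inter_mem hC (ball_mem_nhds z hR)), ?_⟩
  filter_upwards [Metric.tendsto_nhds.1 (hf z hz) (ε / 3) (by positivity)] with i hi y hy
  have h1 : dist (f y) (f z) ≤ ε / 3 :=
    le_of_tendsto ((hf y (hRU hy.2)).dist (hf z hz)) <| univ_mem' fun j ↦
      (hlip j y hy.2).trans hy.1.le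
  have h2 : dist (F i y) (F i z) < ε / 3 := (hlip i y hy.2).trans_lt hy.1
  have h3 := dist_triangle4 (f y) (f z) (F i z) (F i y)
  rw [dist_comm (f z), dist_comm (F i z) (F i y)] at h3
  linarith

/-- A uniformly bounded family of holomorphic functions is totally bounded for uniform convergence
on compact sets. -/
theorem exists_finite_net_of_bounded {U K : Set ℂ} (hU : IsOpen U) (hK : IsCompact K)
    (hKU : K ⊆ U) {S : Set (ℂ → ℂ)} {M : ℝ} (hS : ∀ f ∈ S, DifferentiableOn ℂ f U)
    (hM : ∀ f ∈ S, ∀ z ∈ U, ‖f z‖ ≤ M) {τ : ℝ} (hτ : 0 < τ) :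
    ∃ T ⊆ S, T.Finite ∧ ∀ f ∈ S, ∃ g ∈ T, ∀ z ∈ K, ‖f z - g z‖ < τ := by
  by_contra! H
  -- Otherwise a greedy choice gives a sequence whose terms are pairwise `τ`-separated on `K`.
  obtain ⟨F, hFS, hF⟩ := exists_seq_of_forall_finset_exists (fun f : ℂ → ℂ ↦ f ∈ S)
    (fun g f ↦ ∃ z ∈ K, τ ≤ ‖f z - g z‖) fun s hs ↦ H s (fun x hx ↦ hs x hx) s.finite_toSet
  obtain ⟨f, hf⟩ := exists_tendstoLocallyUniformlyOn_of_bounded (hyperfilter ℕ) hU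
    (fun n ↦ hS _ (hFS n)) (fun n ↦ hM _ (hFS n))
  have hfK := Metric.tendstoUniformlyOn_iff.1
    ((tendstoLocallyUniformlyOn_iff_forall_isCompact hU).1 hf K hKU hK) (τ / 2) (by positivity)
  obtain ⟨m, hm⟩ := hfK.exists
  obtain ⟨n, hn, hmn⟩ := (hfK.and ((eventually_gt_atTop m).filter_mono
    (Nat.cofinite_eq_atTop ▸ hyperfilter_le_cofinite))).exists
  obtain ⟨z, hz, hle⟩ := hF m n hmn
  have := dist_triangle_left (F n z) (F m z) (f z)
  rw [dist_eq_norm] at this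
  linarith [hm z hz, hn z hz]

/-! ### Hurwitz's theorem -/

/-- A quantitative form of **Hurwitz's theorem**: if injective holomorphic functions `F i` converge
locally uniformly to `f`, and `f` is not constant near `b`, then the images under `F i` of a fixed
neighbourhood of `b` eventually contain a fixed disc around `f b`. -/
theorem exists_eventually_ball_subset_image {ι : Type*} {l : Filter ι} [l.NeBot] {U : Set ℂ}
    (hU : IsOpen U) {F : ι → ℂ → ℂ} {f : ℂ → ℂ} (hF : ∀ i, DifferentiableOn ℂ (F i) U)
    (hinj : ∀ i, InjOn (F i) U) (hf : TendstoLocallyUniformlyOn F f l U) {b : ℂ} (hb : b ∈ U)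
    (hfb : ¬ ∀ᶠ z in 𝓝 b, f z = f b) {r : ℝ} (hr : 0 < r) :
    ∃ τ > 0, ∀ᶠ i in l, ball (f b) τ ⊆ F i '' (ball b r ∩ U) := by
  have hfd : DifferentiableOn ℂ f U := hf.differentiableOn (Eventually.of_forall hF) hU
  have hne : ∀ᶠ z in 𝓝[≠] b, f z ≠ f b :=
    ((hfd.analyticAt (hU.mem_nhds hb)).eventually_eq_or_eventually_ne
      analyticAt_const).resolve_left hfb
  obtain ⟨ρ, hρ, hρb⟩ := Metric.mem_nhds_iff.1
    (inter_mem (eventually_nhdsWithin_iff.1 hne) (inter_mem (ball_mem_nhds b hr) (hU.mem_nhds hb)))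
  set s := ρ / 2
  have hs : 0 < s := by positivity
  have hsub : closedBall b s ⊆ ball b r ∩ U := fun z hz ↦
    (hρb (closedBall_subset_ball (by simp only [s]; linarith) hz)).2
  have hsU : closedBall b s ⊆ U := fun z hz ↦ (hsub hz).2
  have hsph : ∀ z ∈ sphere b s, 0 < ‖f z - f b‖ := fun z hz ↦ norm_pos_iff.2 <| sub_ne_zero.2 <|
    (hρb (closedBall_subset_ball (by simp only [s]; linarith) (sphere_subset_closedBall hz))).1
      (ne_of_mem_sphere hz hs.ne')
  obtain ⟨w, hw, hmin⟩ := (isCompact_sphere b s).exists_isMinOn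
    (NormedSpace.sphere_nonempty.2 hs.le)
    (((hfd.continuousOn.mono (sphere_subset_closedBall.trans hsU)).sub continuousOn_const).norm)
  set ε := ‖f w - f b‖
  have hε : 0 < ε := hsph w hw
  refine ⟨ε / 8, by positivity, ?_⟩
  filter_upwards [Metric.tendstoUniformlyOn_iff.1
    ((tendstoLocallyUniformlyOn_iff_forall_isCompact hU).1 hf _ hsU (isCompact_closedBall b s))
    (ε / 8) (by positivity)] with i hi
  have hbi := hi b (mem_closedBall_self hs.le)
  have hdc : DiffContOnCl ℂ (F i) (ball b s) :=
    ((hF i).mono (closure_ball_subset_closedBall.trans hsU)).diffContOnCl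
  have key := hdc.ball_subset_image_closedBall (ε := ε / 2) hs (fun z hz ↦ by
    have h1 := hi z (sphere_subset_closedBall hz)
    have h2 : ε ≤ dist (f z) (f b) := by rw [dist_eq_norm]; exact hmin hz
    have h3 := dist_triangle4 (f z) (F i z) (F i b) (f b)
    rw [dist_comm (F i b)] at h3
    rw [← dist_eq_norm]
    linarith) (by
      have hmem : ∀ᶠ z in 𝓝[≠] b, F i z ≠ F i b := by
        filter_upwards [self_mem_nhdsWithin, mem_nhdsWithin_of_mem_nhds (hU.mem_nhds hb)]
          with z hz hzU h using hz (hinj i hzU hb h)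
      exact hmem.frequently.filter_mono nhdsWithin_le_nhds)
  refine (ball_subset_ball' ?_).trans (key.trans (image_mono hsub))
  linarith

theorem not_eventually_const_of_deriv_ne_zero {U : Set ℂ} (hU : IsOpen U) (hUc : IsPreconnected U)
    {f : ℂ → ℂ} (hf : DifferentiableOn ℂ f U) {a b : ℂ} (ha : a ∈ U) (hb : b ∈ U)
    (hfa : deriv f a ≠ 0) : ¬ ∀ᶠ z in 𝓝 b, f z = f b := by
  intro h
  have hEq := (hf.analyticOnNhd hU).eqOn_of_preconnected_of_eventuallyEq analyticOnNhd_const hUc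
    hb h
  refine hfa ?_
  rw [(hEq.eventuallyEq_of_mem (hU.mem_nhds ha)).deriv_eq]
  simp

/-- **Hurwitz's theorem**: a nonconstant locally uniform limit of injective holomorphic functions is
injective. -/
theorem injOn_of_tendstoLocallyUniformlyOn {ι : Type*} {l : Filter ι} [l.NeBot] {U : Set ℂ}
    (hU : IsOpen U) {F : ι → ℂ → ℂ} {f : ℂ → ℂ} (hF : ∀ i, DifferentiableOn ℂ (F i) U)
    (hinj : ∀ i, InjOn (F i) U) (hf : TendstoLocallyUniformlyOn F f l U)
    (hfc : ∀ b ∈ U, ¬ ∀ᶠ z in 𝓝 b, f z = f b) : InjOn f U := by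
  intro a ha b hb hab
  by_contra hne
  have hd : 0 < dist a b / 2 := by have := dist_pos.2 hne; positivity
  obtain ⟨τ₁, hτ₁, h₁⟩ := exists_eventually_ball_subset_image hU hF hinj hf ha (hfc a ha) hd
  obtain ⟨τ₂, hτ₂, h₂⟩ := exists_eventually_ball_subset_image hU hF hinj hf hb (hfc b hb) hd
  obtain ⟨i, hi₁, hi₂⟩ := (h₁.and h₂).exists
  obtain ⟨x, ⟨hxa, hxU⟩, hx⟩ := hi₁ (mem_ball_self hτ₁)
  obtain ⟨y, ⟨hyb, hyU⟩, hy⟩ := hi₂ (mem_ball_self hτ₂)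
  obtain rfl : x = y := hinj i hxU hyU (by rw [hx, hy, hab])
  have := dist_triangle_left a b x
  rw [mem_ball] at hxa hyb
  linarith

/-- A uniform covering property of bounded univalent functions `f` on the unit disc with
`|f' 0| ≥ c`: the radius `τ` of the disc around `f w` covered by the image of `ball w σ` depends
neither on `f` nor on `w`, as long as `w` stays in a fixed compact subset of the disc. -/
theorem exists_uniform_ball_subset_image {c M ρ σ : ℝ} (hc : 0 < c) (hρ : ρ < 1) (hσ : 0 < σ) :
    ∃ τ > 0, ∀ f : ℂ → ℂ, DifferentiableOn ℂ f (ball 0 1) → InjOn f (ball 0 1) →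
      (∀ z ∈ ball (0 : ℂ) 1, ‖f z‖ ≤ M) → c ≤ ‖deriv f 0‖ →
      ∀ w ∈ closedBall (0 : ℂ) ρ, ball (f w) τ ⊆ f '' (ball w σ ∩ ball 0 1) := by
  by_contra! H
  have h0 : (0 : ℂ) ∈ ball (0 : ℂ) 1 := mem_ball_self one_pos
  -- Counterexamples with `τ = 1 / (n + 1)` have a univalent limit, which satisfies the local
  -- covering property at the limit of the points `w n`.
  choose F hFd hFi hFM hFc w hw hn using fun n : ℕ ↦ H (1 / (n + 1)) (by positivity)
  obtain ⟨f, hf⟩ := exists_tendstoLocallyUniformlyOn_of_bounded (hyperfilter ℕ) isOpen_ball hFd hFM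
  have hfd : DifferentiableOn ℂ f (ball 0 1) :=
    hf.differentiableOn (Eventually.of_forall hFd) isOpen_ball
  have hfc : c ≤ ‖deriv f 0‖ :=
    ge_of_tendsto ((hf.deriv (Eventually.of_forall hFd) isOpen_ball).tendsto_at h0).norm
      (univ_mem' hFc)
  obtain ⟨b, hb, hwb⟩ := (isCompact_closedBall (0 : ℂ) ρ).ultrafilter_le_nhds
    ((hyperfilter ℕ).map w) (by
      rw [Ultrafilter.coe_map, le_principal_iff, mem_map]
      exact univ_mem' hw)
  replace hwb : Tendsto w (hyperfilter ℕ) (𝓝 b) := hwb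
  have hb1 : b ∈ ball (0 : ℂ) 1 := closedBall_subset_ball hρ hb
  obtain ⟨τ, hτ, hcov⟩ := exists_eventually_ball_subset_image isOpen_ball hFd hFi hf hb1
    (not_eventually_const_of_deriv_ne_zero isOpen_ball (convex_ball _ _).isPreconnected hfd h0 hb1
      (norm_pos_iff.1 (hc.trans_le hfc))) (half_pos hσ)
  have hlim : Tendsto (fun n ↦ F n (w n)) (hyperfilter ℕ) (𝓝 (f b)) :=
    hf.tendsto_comp (hfd.continuousOn b hb1) hb1
      (tendsto_nhdsWithin_iff.2 ⟨hwb, hwb.eventually (isOpen_ball.mem_nhds hb1)⟩)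
  have hsmall : ∀ᶠ n : ℕ in hyperfilter ℕ, 1 / ((n : ℝ) + 1) < τ / 2 :=
    ((tendsto_one_div_add_atTop_nhds_zero_nat (𝕜 := ℝ)).eventually_lt_const
      (half_pos hτ)).filter_mono (Nat.cofinite_eq_atTop ▸ hyperfilter_le_cofinite)
  obtain ⟨n, ⟨hn1, hn2⟩, hn3, hn4⟩ := ((hcov.and hsmall).and
    ((Metric.tendsto_nhds.1 hlim _ (half_pos hτ)).and
      (Metric.tendsto_nhds.1 hwb _ (half_pos hσ)))).exists
  refine hn n ((ball_subset_ball' ?_).trans (hn1.trans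
    (image_mono (inter_subset_inter_left _ (ball_subset_ball' ?_)))))
  · linarith
  · rw [dist_comm]; linarith

/-! ### Inverses of injective holomorphic functions -/

/-- The inverse of an injective holomorphic function is holomorphic, and the derivative of such a
function has no zeros. The inverse is continuous by the open mapping theorem and holomorphic away
from the isolated critical values; these are removable singularities. -/
theorem differentiableAt_invFunOn_and_deriv_ne_zero {U : Set ℂ} (hU : IsOpen U) {f : ℂ → ℂ}
    (hf : DifferentiableOn ℂ f U) (hinj : InjOn f U) {z : ℂ} (hz : z ∈ U) :
    DifferentiableAt ℂ (invFunOn f U) (f z) ∧ deriv f z ≠ 0 := by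
  set g := invFunOn f U
  have hgf : ∀ w ∈ U, g (f w) = w := fun w hw ↦ hinj.leftInvOn_invFunOn hw
  have hopen : ∀ w ∈ U, 𝓝 (f w) ≤ map f (𝓝 w) := by
    intro w hw
    refine ((hf.analyticAt (hU.mem_nhds hw)).eventually_constant_or_nhds_le_map_nhds).resolve_left
      fun h ↦ ?_
    have hne : ∀ᶠ y in 𝓝[≠] w, False := by
      filter_upwards [self_mem_nhdsWithin, mem_nhdsWithin_of_mem_nhds (hU.mem_nhds hw),
        h.filter_mono nhdsWithin_le_nhds] with y hy hyU h using hy (hinj hyU hw h)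
    exact (hne.exists).elim fun _ h ↦ h
  have hfg : ∀ w ∈ U, ∀ᶠ y in 𝓝 (f w), f (g y) = y ∧ g y ∈ U := by
    intro w hw
    filter_upwards [hopen w hw (image_mem_map (hU.mem_nhds hw))]
    rintro _ ⟨x, hx, rfl⟩
    rw [hgf x hx]
    exact ⟨rfl, hx⟩
  have hcont : ∀ w ∈ U, ContinuousAt g (f w) := by
    intro w hw
    rw [ContinuousAt, hgf w hw]
    refine (map_mono (hopen w hw)).trans ?_
    rw [Filter.map_map]
    exact (tendsto_id (x := 𝓝 w)).congr' <| by
      filter_upwards [hU.mem_nhds hw] with x hx using (hgf x hx).symm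
  have hdiff : ∀ w ∈ U, deriv f w ≠ 0 → DifferentiableAt ℂ g (f w) := by
    intro w hw hne
    refine (HasDerivAt.of_local_left_inverse (hcont w hw) (f' := deriv f w) ?_ hne
      ((hfg w hw).mono fun y hy ↦ hy.1)).differentiableAt
    rw [hgf w hw]
    exact (hf.differentiableAt (hU.mem_nhds hw)).hasDerivAt
  have hisol : ∀ᶠ w in 𝓝[≠] z, deriv f w ≠ 0 := by
    refine ((hf.analyticAt (hU.mem_nhds hz)).deriv.eventually_eq_zero_or_eventually_ne_zero
      ).resolve_left fun h ↦ ?_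
    obtain ⟨r, hr, hrs⟩ := Metric.mem_nhds_iff.1 (inter_mem h (hU.mem_nhds hz))
    have hconst : ∀ y ∈ ball z r, f y = f z := fun y hy ↦
      isOpen_ball.is_const_of_deriv_eq_zero (convex_ball z r).isPreconnected
        (hf.mono fun x hx ↦ (hrs hx).2) (fun x hx ↦ (hrs hx).1) hy (mem_ball_self hr)
    have hne : ∀ᶠ y in 𝓝[≠] z, False := by
      filter_upwards [self_mem_nhdsWithin, mem_nhdsWithin_of_mem_nhds (ball_mem_nhds z hr)]
        with y hy hyr using
          hy (hinj (hrs hyr).2 hz (hconst y hyr))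
    exact (hne.exists).elim fun _ h ↦ h
  have hgz : DifferentiableAt ℂ g (f z) := by
    refine (Complex.analyticAt_of_differentiable_on_punctured_nhds_of_continuousAt ?_
      (hcont z hz)).differentiableAt
    have hpunct : Tendsto g (𝓝[≠] f z) (𝓝[≠] z) := by
      refine tendsto_nhdsWithin_iff.2 ⟨?_, ?_⟩
      · have := hcont z hz
        rw [ContinuousAt, hgf z hz] at this
        exact this.mono_left nhdsWithin_le_nhds
      · filter_upwards [self_mem_nhdsWithin, (hfg z hz).filter_mono nhdsWithin_le_nhds]
          with y hy hyg h
        rw [mem_singleton_iff] at h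
        exact hy (by rw [← hyg.1, h]; rfl)
    filter_upwards [hpunct.eventually hisol, (hfg z hz).filter_mono nhdsWithin_le_nhds]
      with y hy hyg
    have := hdiff (g y) hyg.2 hy
    rwa [hyg.1] at this
  refine ⟨hgz, fun h0 ↦ ?_⟩
  have hcomp := hgz.hasDerivAt.comp z (hf.differentiableAt (hU.mem_nhds hz)).hasDerivAt
  have hid : HasDerivAt (g ∘ f) 1 z := (hasDerivAt_id z).congr_of_eventuallyEq <| by
    filter_upwards [hU.mem_nhds hz] with x hx using hgf x hx
  have := hcomp.unique hid
  rw [h0, mul_zero] at this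
  exact zero_ne_one this

/-! ### The Riemann mapping theorem for bounded domains -/

/-- The involutive automorphism of the unit disc that exchanges `w` and `0`. -/
noncomputable def discSwap (w z : ℂ) : ℂ := (w - z) / (1 - starRingEnd ℂ w * z)

section discSwap

variable {w z : ℂ}

theorem discSwap_denom_ne_zero (hw : ‖w‖ < 1) (hz : ‖z‖ < 1) : 1 - starRingEnd ℂ w * z ≠ 0 := by
  intro h
  have h1 : ‖starRingEnd ℂ w * z‖ = 1 := by rw [← sub_eq_zero.1 h, norm_one]
  rw [norm_mul, RCLike.norm_conj] at h1
  nlinarith [norm_nonneg w, norm_nonneg z]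

@[simp] theorem discSwap_zero_right : discSwap w 0 = w := by simp [discSwap]

@[simp] theorem discSwap_self : discSwap w w = 0 := by simp [discSwap]

theorem norm_discSwap_lt_one (hw : ‖w‖ < 1) (hz : ‖z‖ < 1) : ‖discSwap w z‖ < 1 := by
  have hne := discSwap_denom_ne_zero hw hz
  rw [discSwap, norm_div, div_lt_one (norm_pos_iff.2 hne), ← sq_lt_sq₀ (norm_nonneg _)
    (norm_nonneg _), ← Complex.normSq_eq_norm_sq, ← Complex.normSq_eq_norm_sq]
  have hw2 : Complex.normSq w < 1 := by
    rw [Complex.normSq_eq_norm_sq]; nlinarith [norm_nonneg w]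
  have hz2 : Complex.normSq z < 1 := by
    rw [Complex.normSq_eq_norm_sq]; nlinarith [norm_nonneg z]
  have key : Complex.normSq (1 - starRingEnd ℂ w * z) - Complex.normSq (w - z) =
      (1 - Complex.normSq w) * (1 - Complex.normSq z) := by
    simp only [Complex.normSq_apply, Complex.sub_re, Complex.sub_im, Complex.mul_re,
      Complex.mul_im, Complex.one_re, Complex.one_im, Complex.conj_re, Complex.conj_im]
    ring
  nlinarith [mul_pos (sub_pos.2 hw2) (sub_pos.2 hz2)]

theorem discSwap_discSwap (hw : ‖w‖ < 1) (hz : ‖z‖ < 1) : discSwap w (discSwap w z) = z := by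
  have h1 := discSwap_denom_ne_zero hw hz
  have h2 := discSwap_denom_ne_zero hw (norm_discSwap_lt_one hw hz)
  have h3 : discSwap w z * (1 - starRingEnd ℂ w * z) = w - z := div_mul_cancel₀ _ h1
  rw [discSwap, div_eq_iff h2]
  linear_combination -h3

theorem discSwap_eq_zero_iff (hw : ‖w‖ < 1) (hz : ‖z‖ < 1) : discSwap w z = 0 ↔ z = w := by
  rw [discSwap, div_eq_zero_iff, or_iff_left (discSwap_denom_ne_zero hw hz), sub_eq_zero, eq_comm]

theorem hasDerivAt_discSwap (hw : ‖w‖ < 1) (hz : ‖z‖ < 1) :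
    HasDerivAt (discSwap w) (-(1 - (‖w‖ : ℂ) ^ 2) / (1 - starRingEnd ℂ w * z) ^ 2) z := by
  have h := ((hasDerivAt_id z).const_sub w).fun_div
    (((hasDerivAt_id z).const_mul (starRingEnd ℂ w)).const_sub 1) (discSwap_denom_ne_zero hw hz)
  refine h.congr_deriv ?_
  rw [← Complex.conj_mul']
  simp only [id]
  ring

end discSwap

/-- A continuous square root of a zero-free holomorphic function is holomorphic. -/
theorem hasDerivAt_of_sq_eq {U : Set ℂ} (hU : IsOpen U) {h g : ℂ → ℂ} (hc : ContinuousOn h U)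
    (hsq : ∀ z ∈ U, h z ^ 2 = g z) {z g' : ℂ} (hz : z ∈ U) (h0 : h z ≠ 0)
    (hg : HasDerivAt g g' z) : HasDerivAt h (g' / (2 * h z)) z := by
  rw [hasDerivAt_iff_tendsto_slope] at hg ⊢
  have h2 : 2 * h z ≠ 0 := mul_ne_zero two_ne_zero h0
  have hcz : Tendsto (fun y ↦ h y + h z) (𝓝[≠] z) (𝓝 (2 * h z)) := by
    rw [two_mul]
    exact ((hc.continuousAt (hU.mem_nhds hz)).add continuousAt_const).mono_left nhdsWithin_le_nhds
  refine (hg.div hcz h2).congr' ?_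
  filter_upwards [mem_nhdsWithin_of_mem_nhds (hU.mem_nhds hz),
    hcz.eventually_ne h2] with y hy hne
  rw [Pi.div_apply, slope_def_field, slope_def_field, ← hsq y hy, ← hsq z hz, div_right_comm]
  congr 1
  rw [div_eq_iff hne]
  ring

/-- The competitors in the extremal problem that gives the Riemann map: injective holomorphic maps
of `U` into the unit disc which fix the origin. -/
structure IsDiscEmbedding (U : Set ℂ) (f : ℂ → ℂ) : Prop where
  differentiableOn : DifferentiableOn ℂ f U
  injOn : InjOn f U
  norm_lt_one : ∀ z ∈ U, ‖f z‖ < 1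
  map_zero : f 0 = 0

/-- Koebe's square root trick: an embedding into the disc which omits a value is not extremal, as
the derivative at the origin grows by the factor `(1 + |w|) / (2 √|w|)` when a square root is
taken after the omitted value `w` has been moved to the origin. -/
theorem IsDiscEmbedding.exists_norm_deriv_lt {U : Set ℂ} (hU : IsOpen U)
    (hUc : IsSimplyConnected U) (h0 : 0 ∈ U) {f : ℂ → ℂ} (hf : IsDiscEmbedding U f) {w : ℂ}
    (hw : ‖w‖ < 1) (hfw : ∀ z ∈ U, f z ≠ w) (hd : deriv f 0 ≠ 0) :
    ∃ g, IsDiscEmbedding U g ∧ ‖deriv f 0‖ < ‖deriv g 0‖ := by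
  have hw0 : w ≠ 0 := fun h ↦ hfw 0 h0 (by rw [hf.map_zero, h])
  have hder : ∀ z ∈ U, HasDerivAt (discSwap w ∘ f)
      (-(1 - (‖w‖ : ℂ) ^ 2) / (1 - starRingEnd ℂ w * f z) ^ 2 * deriv f z) z := fun z hz ↦
    (hasDerivAt_discSwap hw (hf.norm_lt_one z hz)).comp z
      (hf.differentiableOn.differentiableAt (hU.mem_nhds hz)).hasDerivAt
  obtain ⟨h, hhc, hh⟩ := Complex.exists_continuousOn_pow_eq hUc hU (g := discSwap w ∘ f)
    (fun z hz ↦ (hder z hz).continuousAt.continuousWithinAt) (by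
      rintro ⟨z, hz, h⟩
      exact hfw z hz ((discSwap_eq_zero_iff hw (hf.norm_lt_one z hz)).1 h)) two_ne_zero
  have hh0 : ∀ z ∈ U, h z ≠ 0 := by
    intro z hz h'
    have := hh z
    rw [h', zero_pow two_ne_zero] at this
    exact hfw z hz ((discSwap_eq_zero_iff hw (hf.norm_lt_one z hz)).1 this.symm)
  have hh1 : ∀ z ∈ U, ‖h z‖ < 1 := fun z hz ↦ by
    rw [← pow_lt_one_iff_of_nonneg (norm_nonneg _) two_ne_zero, ← norm_pow, hh z]
    exact norm_discSwap_lt_one hw (hf.norm_lt_one z hz)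
  have hhd := fun z hz ↦ hasDerivAt_of_sq_eq hU hhc (fun z _ ↦ hh z) hz (hh0 z hz) (hder z hz)
  set v := h 0
  have hv : ‖v‖ < 1 := hh1 0 h0
  have hgd := fun z hz ↦ (hasDerivAt_discSwap hv (hh1 z hz)).comp z (hhd z hz)
  refine ⟨discSwap v ∘ h, ⟨fun z hz ↦ (hgd z hz).differentiableAt.differentiableWithinAt, ?_,
    fun z hz ↦ norm_discSwap_lt_one hv (hh1 z hz), by simp [v]⟩, ?_⟩
  · intro a ha b hb hab
    have h1 : h a = h b := by
      rw [← discSwap_discSwap hv (hh1 a ha), ← discSwap_discSwap hv (hh1 b hb)]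
      exact congrArg _ hab
    have h2 : discSwap w (f a) = discSwap w (f b) := by
      have := hh a
      rw [h1, hh b] at this
      exact this.symm
    refine hf.injOn ha hb ?_
    rw [← discSwap_discSwap hw (hf.norm_lt_one a ha), ← discSwap_discSwap hw (hf.norm_lt_one b hb),
      h2]
  · have hvw : v ^ 2 = w := by rw [hh 0]; simp [hf.map_zero]
    have hv0 : 0 < ‖v‖ := norm_pos_iff.2 (hh0 0 h0)
    rw [(hgd 0 h0).deriv, hf.map_zero, ← hvw]
    have hcv : starRingEnd ℂ v * h 0 = (‖v‖ : ℂ) ^ 2 := Complex.conj_mul' v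
    have hpos : 0 < 1 - ‖v‖ ^ 2 := by nlinarith
    have hpos' : (1 - (‖v‖ : ℂ) ^ 2) ≠ 0 := by exact_mod_cast hpos.ne'
    have hval : -(1 - (‖v‖ : ℂ) ^ 2) / (1 - starRingEnd ℂ v * h 0) ^ 2 *
        (-(1 - (‖v ^ 2‖ : ℂ) ^ 2) / (1 - starRingEnd ℂ (v ^ 2) * 0) ^ 2 * deriv f 0 / (2 * h 0)) =
        ((1 + ‖v‖ ^ 2 : ℝ) : ℂ) / (2 * v) * deriv f 0 := by
      have hvne : v ≠ 0 := hh0 0 h0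
      rw [hcv, norm_pow]
      simp only [show h 0 = v from rfl]
      push_cast
      field_simp
      ring
    rw [hval, norm_mul, norm_div, norm_mul, Complex.norm_real, Complex.norm_ofNat,
      Real.norm_of_nonneg (by positivity)]
    refine lt_mul_of_one_lt_left (norm_pos_iff.2 hd) ?_
    rw [one_lt_div (by positivity)]
    nlinarith [sq_pos_of_pos (sub_pos.2 hv)]

/-- The **Riemann mapping theorem** for bounded domains. A limit of disc embeddings whose
derivatives at the origin approach the supremum is again a disc embedding, and the square root trick
shows that it is onto. -/
theorem exists_isNormalizedConformal {U : Set ℂ} (hU : IsOpen U) (hUc : IsSimplyConnected U)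
    (h0 : 0 ∈ U) (hUb : Bornology.IsBounded U) : ∃ φ, IsNormalizedConformal U φ := by
  obtain ⟨M, hM0, hM⟩ := hUb.exists_pos_norm_lt
  obtain ⟨r, hr, hrU⟩ := Metric.isOpen_iff.1 hU 0 h0
  set S : Set ℝ := (fun f ↦ ‖deriv f 0‖) '' {f | IsDiscEmbedding U f}
  have hMc : (M : ℂ) ≠ 0 := by exact_mod_cast hM0.ne'
  have hscale : IsDiscEmbedding U fun z ↦ z / M :=
    ⟨by fun_prop, fun a _ b _ hab ↦ (div_left_inj' hMc).1 hab, fun z hz ↦ by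
      rw [norm_div, Complex.norm_real, Real.norm_of_nonneg hM0.le, div_lt_one hM0]
      exact hM z hz, by simp⟩
  have hSne : S.Nonempty := ⟨_, _, hscale, rfl⟩
  have hSb : BddAbove S := by
    refine ⟨1 / r, ?_⟩
    rintro _ ⟨f, hf, rfl⟩
    refine Complex.norm_deriv_le_div_of_mapsTo_ball (hf.differentiableOn.mono hrU) (fun z hz ↦ ?_)
      hr
    rw [hf.map_zero, mem_closedBall_zero_iff]
    exact (hf.norm_lt_one z (hrU hz)).le
  obtain ⟨u, -, hu, huS⟩ := exists_seq_tendsto_sSup hSne hSb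
  choose F hF hFu using huS
  obtain ⟨f, hf⟩ := exists_tendstoLocallyUniformlyOn_of_bounded (hyperfilter ℕ) hU
    (fun n ↦ (hF n).differentiableOn) (fun n z hz ↦ ((hF n).norm_lt_one z hz).le)
  have hfd : DifferentiableOn ℂ f U :=
    hf.differentiableOn (Eventually.of_forall fun n ↦ (hF n).differentiableOn) hU
  have hlim : ‖deriv f 0‖ = sSup S :=
    tendsto_nhds_unique ((hf.deriv (Eventually.of_forall fun n ↦ (hF n).differentiableOn)
      hU).tendsto_at h0).norm
      ((hu.mono_left (Nat.cofinite_eq_atTop ▸ hyperfilter_le_cofinite)).congr fun n ↦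
        (hFu n).symm)
  have hpos : 0 < ‖deriv f 0‖ := by
    rw [hlim]
    refine lt_of_lt_of_le ?_ (le_csSup hSb ⟨_, hscale, rfl⟩)
    simp [hM0.ne']
  have hnc := fun b (hb : b ∈ U) ↦ not_eventually_const_of_deriv_ne_zero hU
    hUc.isPathConnected.isConnected.isPreconnected hfd h0 hb (norm_pos_iff.1 hpos)
  have hfe : IsDiscEmbedding U f := by
    refine ⟨hfd, injOn_of_tendstoLocallyUniformlyOn hU (fun n ↦ (hF n).differentiableOn)
      (fun n ↦ (hF n).injOn) hf hnc, fun z hz ↦ ?_, ?_⟩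
    -- A value of the limit is also a value of some `F n`, hence lies in the open disc.
    · obtain ⟨τ, hτ, h⟩ := exists_eventually_ball_subset_image hU
        (fun n ↦ (hF n).differentiableOn) (fun n ↦ (hF n).injOn) hf hz (hnc z hz) one_pos
      obtain ⟨n, hn⟩ := h.exists
      obtain ⟨y, hy, hyz⟩ := hn (mem_ball_self hτ)
      rw [← hyz]
      exact (hF n).norm_lt_one y hy.2
    · refine tendsto_nhds_unique (hf.tendsto_at h0) ?_
      simp [(hF _).map_zero]
  have hsurj : SurjOn f U (ball 0 1) := by
    intro w hw
    by_contra hne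
    obtain ⟨g, hg, hlt⟩ := hfe.exists_norm_deriv_lt hU hUc h0 (mem_ball_zero_iff.1 hw)
      (fun z hz h ↦ hne ⟨z, hz, h⟩) (norm_pos_iff.1 hpos)
    exact absurd (le_csSup hSb ⟨g, hg, rfl⟩) (by rw [← hlim]; exact not_le.2 hlt)
  -- A rotation makes the derivative at the origin positive.
  set a : ℂ := starRingEnd ℂ (deriv f 0) / ‖deriv f 0‖
  have ha : ‖a‖ = 1 := by
    simp [a, hpos.ne']
  have ha0 : a ≠ 0 := by rintro h; simp [h] at ha
  have hda : deriv (fun z ↦ a * f z) 0 = (‖deriv f 0‖ : ℂ) := by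
    rw [deriv_const_mul_field]
    have : (‖deriv f 0‖ : ℂ) ≠ 0 := by exact_mod_cast hpos.ne'
    simp only [a]
    rw [div_mul_eq_mul_div, Complex.conj_mul', sq, mul_div_assoc, div_self this, mul_one]
  refine ⟨fun z ↦ a * f z, hfd.const_mul a, ⟨fun z hz ↦ ?_, fun x hx y hy hxy ↦
    hfe.injOn hx hy (mul_left_cancel₀ ha0 hxy), fun w hw ↦ ?_⟩, by simp [hfe.map_zero], ?_, ?_⟩
  · simpa [ha] using hfe.norm_lt_one z hz
  · obtain ⟨z, hz, hzw⟩ := hsurj (show a⁻¹ * w ∈ ball 0 1 by simpa [ha] using hw)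
    exact ⟨z, hz, by simp only [hzw]; field_simp⟩
  · rw [hda, Complex.ofReal_im]
  · rwa [hda, Complex.ofReal_re]

/-! ### Normalized conformal maps and their inverses -/

namespace IsNormalizedConformal

variable {D : Set ℂ} {φ ψ : ℂ → ℂ}

theorem mapsTo_inv (hφ : IsNormalizedConformal D φ) : MapsTo (invFunOn φ D) (ball 0 1) D :=
  hφ.bijOn.surjOn.mapsTo_invFunOn

theorem apply_inv (hφ : IsNormalizedConformal D φ) {w : ℂ} (hw : w ∈ ball (0 : ℂ) 1) :
    φ (invFunOn φ D w) = w :=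
  hφ.bijOn.surjOn.rightInvOn_invFunOn hw

theorem inv_apply (hφ : IsNormalizedConformal D φ) {z : ℂ} (hz : z ∈ D) :
    invFunOn φ D (φ z) = z :=
  hφ.bijOn.injOn.leftInvOn_invFunOn hz

theorem inv_zero (hφ : IsNormalizedConformal D φ) (h0 : 0 ∈ D) : invFunOn φ D 0 = 0 := by
  simpa only [hφ.map_zero] using hφ.inv_apply h0

theorem injOn_inv (hφ : IsNormalizedConformal D φ) : InjOn (invFunOn φ D) (ball 0 1) :=
  hφ.bijOn.surjOn.rightInvOn_invFunOn.injOn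

theorem differentiableOn_inv (hφ : IsNormalizedConformal D φ) (hD : IsOpen D) :
    DifferentiableOn ℂ (invFunOn φ D) (ball 0 1) := by
  intro w hw
  have := (differentiableAt_invFunOn_and_deriv_ne_zero hD hφ.differentiableOn hφ.bijOn.injOn
    (hφ.mapsTo_inv hw)).1
  rw [hφ.apply_inv hw] at this
  exact this.differentiableWithinAt

theorem deriv_ne_zero (hφ : IsNormalizedConformal D φ) : deriv φ 0 ≠ 0 := fun h ↦ by
  simpa [h] using hφ.deriv_re

theorem deriv_eq_norm (hφ : IsNormalizedConformal D φ) : deriv φ 0 = (‖deriv φ 0‖ : ℂ) := by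
  have h : deriv φ 0 = ((deriv φ 0).re : ℂ) := Complex.ext rfl hφ.deriv_im
  rw [h, Complex.norm_real, Real.norm_of_nonneg]
  exact hφ.deriv_re.le

theorem hasDerivAt_inv (hφ : IsNormalizedConformal D φ) (hD : IsOpen D) (h0 : 0 ∈ D) :
    HasDerivAt (invFunOn φ D) (deriv φ 0)⁻¹ 0 := by
  have h01 : (0 : ℂ) ∈ ball (0 : ℂ) 1 := mem_ball_self one_pos
  refine HasDerivAt.of_local_left_inverse (f := φ) ?_ ?_ hφ.deriv_ne_zero ?_
  · exact (hφ.differentiableOn_inv hD).continuousOn.continuousAt (isOpen_ball.mem_nhds h01)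
  · rw [hφ.inv_zero h0]
    exact (hφ.differentiableOn.differentiableAt (hD.mem_nhds h0)).hasDerivAt
  · filter_upwards [isOpen_ball.mem_nhds h01] with w hw using hφ.apply_inv hw

theorem hasDerivAt_comp_inv (hφ : IsNormalizedConformal D φ) (hψ : IsNormalizedConformal D ψ)
    (hD : IsOpen D) (h0 : 0 ∈ D) :
    HasDerivAt (ψ ∘ invFunOn φ D) (deriv ψ 0 * (deriv φ 0)⁻¹) 0 := by
  refine HasDerivAt.comp 0 ?_ (hφ.hasDerivAt_inv hD h0)
  rw [hφ.inv_zero h0]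
  exact (hψ.differentiableOn.differentiableAt (hD.mem_nhds h0)).hasDerivAt

theorem differentiableOn_comp_inv (hφ : IsNormalizedConformal D φ)
    (hψ : IsNormalizedConformal D ψ) (hD : IsOpen D) :
    DifferentiableOn ℂ (ψ ∘ invFunOn φ D) (ball 0 1) :=
  hψ.differentiableOn.comp (hφ.differentiableOn_inv hD) hφ.mapsTo_inv

theorem mapsTo_comp_inv (hφ : IsNormalizedConformal D φ) (hψ : IsNormalizedConformal D ψ)
    (h0 : 0 ∈ D) : MapsTo (ψ ∘ invFunOn φ D) (ball 0 1)
      (closedBall ((ψ ∘ invFunOn φ D) 0) 1) := by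
  intro w hw
  rw [comp_apply, comp_apply, hφ.inv_zero h0, hψ.map_zero]
  exact ball_subset_closedBall (hψ.bijOn.mapsTo (hφ.mapsTo_inv hw))

theorem norm_deriv_le (hφ : IsNormalizedConformal D φ) (hψ : IsNormalizedConformal D ψ)
    (hD : IsOpen D) (h0 : 0 ∈ D) : ‖deriv ψ 0‖ ≤ ‖deriv φ 0‖ := by
  have h := Complex.norm_deriv_le_one_of_mapsTo_ball (hφ.differentiableOn_comp_inv hψ hD)
    (hφ.mapsTo_comp_inv hψ h0) one_pos
  rw [(hφ.hasDerivAt_comp_inv hψ hD h0).deriv, norm_mul, norm_inv, ← div_eq_mul_inv,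
    div_le_one (norm_pos_iff.2 hφ.deriv_ne_zero)] at h
  exact h

/-- Uniqueness of the normalized conformal map, by the equality case of the Schwarz lemma. -/
theorem eqOn (hφ : IsNormalizedConformal D φ) (hψ : IsNormalizedConformal D ψ)
    (hD : IsOpen D) (h0 : 0 ∈ D) : EqOn ψ φ D := by
  have hd : deriv ψ 0 = deriv φ 0 := by
    rw [hψ.deriv_eq_norm, hφ.deriv_eq_norm,
      (hφ.norm_deriv_le hψ hD h0).antisymm (hψ.norm_deriv_le hφ hD h0)]
  have hF := hφ.hasDerivAt_comp_inv hψ hD h0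
  rw [hd, mul_inv_cancel₀ hφ.deriv_ne_zero] at hF
  have haff := Complex.affine_of_mapsTo_ball_of_norm_dslope_eq_div
    (hφ.differentiableOn_comp_inv hψ hD) (hφ.mapsTo_comp_inv hψ h0) (mem_ball_self one_pos)
    (by simp [hF.deriv])
  intro z hz
  have h := haff (hφ.bijOn.mapsTo hz)
  simpa [hφ.inv_apply hz, hφ.inv_zero h0, hψ.map_zero, hF.deriv] using h

/-- The Schwarz lemma for the derivative of the conformal map of a domain containing a disc. -/
theorem norm_deriv_le_inv_of_ball_subset (hφ : IsNormalizedConformal D φ) {r : ℝ} (hr : 0 < r)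
    (hrD : ball 0 r ⊆ D) : ‖deriv φ 0‖ ≤ r⁻¹ := by
  rw [← one_div]
  refine Complex.norm_deriv_le_div_of_mapsTo_ball (hφ.differentiableOn.mono hrD) (fun z hz ↦ ?_) hr
  rw [hφ.map_zero]
  exact ball_subset_closedBall (hφ.bijOn.mapsTo (hrD hz))

/-! ### The domain inside a level curve of the conformal map -/

variable {ρ : ℝ}

theorem image_ball_subset (hφ : IsNormalizedConformal D φ) (hρ1 : ρ < 1) :
    invFunOn φ D '' ball 0 ρ ⊆ D :=
  (hφ.mapsTo_inv.mono_left (ball_subset_ball hρ1.le)).image_subset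

theorem image_ball_eq (hφ : IsNormalizedConformal D φ) (hρ1 : ρ < 1) :
    invFunOn φ D '' ball 0 ρ = D ∩ φ ⁻¹' ball 0 ρ := by
  ext z
  refine ⟨?_, fun h ↦ ⟨φ z, h.2, hφ.inv_apply h.1⟩⟩
  rintro ⟨w, hw, rfl⟩
  have hw1 := ball_subset_ball hρ1.le hw
  exact ⟨hφ.mapsTo_inv hw1, by rwa [mem_preimage, hφ.apply_inv hw1]⟩

theorem isOpen_image_ball (hφ : IsNormalizedConformal D φ) (hD : IsOpen D) (hρ1 : ρ < 1) :
    IsOpen (invFunOn φ D '' ball 0 ρ) := by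
  rw [hφ.image_ball_eq hρ1]
  exact hφ.differentiableOn.continuousOn.isOpen_inter_preimage hD isOpen_ball

theorem continuousOn_inv_closedBall (hφ : IsNormalizedConformal D φ) (hD : IsOpen D)
    (hρ1 : ρ < 1) : ContinuousOn (invFunOn φ D) (closedBall 0 ρ) :=
  (hφ.differentiableOn_inv hD).continuousOn.mono (closedBall_subset_ball hρ1)

theorem closure_image_ball_subset (hφ : IsNormalizedConformal D φ) (hD : IsOpen D) (hρ1 : ρ < 1) :
    closure (invFunOn φ D '' ball 0 ρ) ⊆ invFunOn φ D '' closedBall 0 ρ :=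
  closure_minimal (image_mono ball_subset_closedBall)
    ((isCompact_closedBall 0 ρ).image_of_continuousOn
      (hφ.continuousOn_inv_closedBall hD hρ1)).isClosed

theorem frontier_image_ball_subset (hφ : IsNormalizedConformal D φ) (hD : IsOpen D) (hρ1 : ρ < 1) :
    frontier (invFunOn φ D '' ball 0 ρ) ⊆ invFunOn φ D '' sphere 0 ρ := by
  rw [(hφ.isOpen_image_ball hD hρ1).frontier_eq]
  rintro z ⟨hz, hz'⟩
  obtain ⟨w, hw, rfl⟩ := hφ.closure_image_ball_subset hD hρ1 hz
  refine ⟨w, ?_, rfl⟩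
  rw [← closedBall_sdiff_ball]
  exact ⟨hw, fun h ↦ hz' ⟨w, h, rfl⟩⟩

theorem isSimplyConnected_image_ball (hφ : IsNormalizedConformal D φ) (hD : IsOpen D)
    (hρ0 : 0 < ρ) (hρ1 : ρ < 1) : IsSimplyConnected (invFunOn φ D '' ball 0 ρ) := by
  have hsub : ball (0 : ℂ) ρ ⊆ ball 0 1 := ball_subset_ball hρ1.le
  have hleft : ∀ z ∈ invFunOn φ D '' ball 0 ρ, φ z ∈ ball (0 : ℂ) ρ := fun z hz ↦ by
    rw [hφ.image_ball_eq hρ1] at hz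
    exact hz.2
  let e : ball (0 : ℂ) ρ ≃ₜ invFunOn φ D '' ball 0 ρ :=
    { toFun := (mapsTo_image _ _).restrict _ _ _
      invFun := MapsTo.restrict φ _ _ hleft
      left_inv := fun w ↦ Subtype.ext (hφ.apply_inv (hsub w.2))
      right_inv := fun z ↦ Subtype.ext (hφ.inv_apply (hφ.image_ball_subset hρ1 z.2))
      continuous_toFun :=
        ((hφ.differentiableOn_inv hD).continuousOn.mono hsub).mapsToRestrict _
      continuous_invFun :=
        (hφ.differentiableOn.continuousOn.mono (hφ.image_ball_subset hρ1)).mapsToRestrict _ }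
  have := (convex_ball (0 : ℂ) ρ).contractibleSpace ⟨0, mem_ball_self hρ0⟩
  have hs : SimplyConnectedSpace (ball (0 : ℂ) ρ) := inferInstance
  exact e.toHomotopyEquiv.simplyConnectedSpace_iff.1 hs

theorem div_const (hφ : IsNormalizedConformal D φ) (hρ0 : 0 < ρ) (hρ1 : ρ < 1) :
    IsNormalizedConformal (invFunOn φ D '' ball 0 ρ) fun z ↦ φ z / ρ := by
  have hρ : (ρ : ℂ) ≠ 0 := by exact_mod_cast hρ0.ne'
  have hsub := hφ.image_ball_subset hρ1
  refine ⟨(hφ.differentiableOn.mono hsub).div_const _, ⟨fun z hz ↦ ?_, fun x hx y hy hxy ↦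
    hφ.bijOn.injOn (hsub hx) (hsub hy) ((div_left_inj' hρ).1 hxy), fun w hw ↦ ?_⟩,
    by simp [hφ.map_zero], ?_, ?_⟩
  · rw [hφ.image_ball_eq hρ1] at hz
    have := mem_ball_zero_iff.1 hz.2
    rw [mem_ball_zero_iff, norm_div, Complex.norm_real, Real.norm_of_nonneg hρ0.le]
    exact (div_lt_one hρ0).2 this
  · have hmem : (ρ : ℂ) * w ∈ ball (0 : ℂ) ρ := by
      rw [mem_ball_zero_iff, norm_mul, Complex.norm_real, Real.norm_of_nonneg hρ0.le]
      exact mul_lt_of_lt_one_right hρ0 (mem_ball_zero_iff.1 hw)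
    refine ⟨_, ⟨_, hmem, rfl⟩, ?_⟩
    simp only [hφ.apply_inv (ball_subset_ball hρ1.le hmem)]
    field_simp
  · rw [deriv_div_const, Complex.div_ofReal_im, hφ.deriv_im, zero_div]
  · rw [deriv_div_const, Complex.div_ofReal_re]
    exact div_pos hφ.deriv_re hρ0

theorem zero_mem_image_ball (hφ : IsNormalizedConformal D φ) (h0 : 0 ∈ D) (hρ0 : 0 < ρ) :
    0 ∈ invFunOn φ D '' ball 0 ρ :=
  ⟨0, mem_ball_self hρ0, hφ.inv_zero h0⟩

theorem isNormalizedConformal_conformalMap (hφ : IsNormalizedConformal D φ) :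
    IsNormalizedConformal D (conformalMap D) :=
  Classical.epsilon_spec (p := IsNormalizedConformal D) ⟨φ, hφ⟩

theorem conformalMap_image_ball (hφ : IsNormalizedConformal D φ) (hD : IsOpen D) (h0 : 0 ∈ D)
    (hρ0 : 0 < ρ) (hρ1 : ρ < 1) :
    EqOn (conformalMap (invFunOn φ D '' ball 0 ρ)) (fun z ↦ φ z / ρ)
      (invFunOn φ D '' ball 0 ρ) :=
  have h := hφ.div_const hρ0 hρ1
  h.eqOn h.isNormalizedConformal_conformalMap (hφ.isOpen_image_ball hD hρ1)
    (hφ.zero_mem_image_ball h0 hρ0)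

/-- The inverse conformal map of the domain inside a level curve is a rescaling of the original
inverse map, also on the unit circle. -/
theorem conformalInv_image_ball (hφ : IsNormalizedConformal D φ) (hD : IsOpen D) (h0 : 0 ∈ D)
    (hρ0 : 0 < ρ) (hρ1 : ρ < 1) :
    EqOn (conformalInv (invFunOn φ D '' ball 0 ρ)) (fun ξ ↦ invFunOn φ D (ρ * ξ))
      (closedBall 0 1) := by
  have hρ : (ρ : ℂ) ≠ 0 := by exact_mod_cast hρ0.ne'
  have hnorm : ∀ ξ : ℂ, ‖(ρ : ℂ) * ξ‖ = ρ * ‖ξ‖ := fun ξ ↦ by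
    rw [norm_mul, Complex.norm_real, Real.norm_of_nonneg hρ0.le]
  set D' := invFunOn φ D '' ball 0 ρ with hD'
  have hχ : IsNormalizedConformal D' (conformalMap D') :=
    (hφ.div_const hρ0 hρ1).isNormalizedConformal_conformalMap
  have hinner : ∀ ξ ∈ ball (0 : ℂ) 1, invFunOn φ D (ρ * ξ) = invFunOn (conformalMap D') D' ξ := by
    intro ξ hξ
    have hmem : (ρ : ℂ) * ξ ∈ ball (0 : ℂ) ρ := by
      rw [mem_ball_zero_iff, hnorm]
      exact mul_lt_of_lt_one_right hρ0 (mem_ball_zero_iff.1 hξ)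
    have hz : invFunOn φ D (ρ * ξ) ∈ D' := ⟨_, hmem, rfl⟩
    have hval : conformalMap D' (invFunOn φ D (ρ * ξ)) = ξ := by
      rw [hφ.conformalMap_image_ball hD h0 hρ0 hρ1 hz]
      simp only [hφ.apply_inv (ball_subset_ball hρ1.le hmem)]
      field_simp
    rw [← hχ.inv_apply hz, hval]
  intro ξ hξ
  refine extendFrom_eq (by rwa [closure_ball _ one_ne_zero]) ?_
  have hmem : (ρ : ℂ) * ξ ∈ ball (0 : ℂ) 1 := by
    rw [mem_ball_zero_iff, hnorm]
    have := mem_closedBall_zero_iff.1 hξ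
    nlinarith
  have hcont : ContinuousAt (fun ξ : ℂ ↦ invFunOn φ D (ρ * ξ)) ξ :=
    ((hφ.differentiableOn_inv hD).continuousOn.continuousAt
      (isOpen_ball.mem_nhds hmem)).comp (f := fun ξ : ℂ ↦ (ρ : ℂ) * ξ) (by fun_prop)
  exact (hcont.mono_left nhdsWithin_le_nhds).congr' <|
    eventually_nhdsWithin_of_forall hinner

theorem continuousOn_conformalInv_image_ball (hφ : IsNormalizedConformal D φ) (hD : IsOpen D)
    (h0 : 0 ∈ D) (hρ0 : 0 < ρ) (hρ1 : ρ < 1) :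
    ContinuousOn (conformalInv (invFunOn φ D '' ball 0 ρ)) (closedBall 0 1) := by
  refine ContinuousOn.congr ?_ (hφ.conformalInv_image_ball hD h0 hρ0 hρ1)
  refine (hφ.continuousOn_inv_closedBall hD hρ1).comp (by fun_prop) fun ξ hξ ↦ ?_
  rw [mem_closedBall_zero_iff] at hξ ⊢
  rw [norm_mul, Complex.norm_real, Real.norm_of_nonneg hρ0.le]
  exact mul_le_of_le_one_right hρ0.le hξ

end IsNormalizedConformal

/-! ### Approximation by finitely many domains -/

theorem ball_subset_of_mem_domainClass {B D : Set ℂ} (hD : D ∈ domainClass B) :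
    ball 0 (1 / 2) ⊆ D := by
  have hrad := hD.2.2.2
  have hne : {R : ℝ | 0 ≤ R ∧ R • ball (0 : ℂ) 1 ⊆ D}.Nonempty := by
    -- The supremum of the empty set is `0` by convention, which is less than `1 / 2`.
    by_contra h
    rw [innerRadius, not_nonempty_iff_eq_empty.1 h, Real.sSup_empty] at hrad
    norm_num at hrad
  obtain ⟨R, ⟨hR0, hR⟩, hlt⟩ := exists_lt_of_lt_csSup hne hrad
  have hRpos : 0 < R := by linarith
  rw [_root_.smul_ball hRpos.ne', smul_zero, Real.norm_of_nonneg hR0, mul_one] at hR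
  exact (ball_subset_ball hlt.le).trans hR

theorem isNormalizedConformal_of_mem_domainClass {B D : Set ℂ} (hB : Bornology.IsBounded B)
    (hD : D ∈ domainClass B) : IsNormalizedConformal D (conformalMap D) := by
  obtain ⟨φ, hφ⟩ := exists_isNormalizedConformal hD.2.1.1 hD.2.2.1
    (ball_subset_of_mem_domainClass hD (mem_ball_self (by norm_num))) (hB.subset hD.1)
  exact hφ.isNormalizedConformal_conformalMap

theorem mainTheorem11 (B : Set ℂ) (hB : IsPlaneDomain B) (hB_bdd : Bornology.IsBounded B)
    (hB_rad : 1 / 2 < innerRadius B) (ε η : ℝ) (hε : 0 < ε) (hη : 0 < η) :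
    ∃ δ₀ : ℝ, 0 < δ₀ ∧ ∃ F : Set (Set ℂ), F.Finite ∧
      (∀ D' ∈ F, IsPlaneDomain D' ∧ IsSimplyConnected D' ∧ 0 ∈ D' ∧ D' ⊆ B ∧
        ContinuousOn (conformalInv D') (closedBall 0 1)) ∧
      ∀ D ∈ domainClass B, ∃ D' ∈ F,
        (D' ⊆ D ∧ closure D' ⊆ D) ∧
        (∀ a ∈ D, ‖conformalMap D a‖ ≤ 1 - ε →
          a ∈ D' ∧ ‖conformalMap D' a‖ ≤ 1 - ε / 2) ∧
        (∀ ξ ∈ frontier D', 1 - η ≤ ‖conformalMap D ξ‖) ∧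
        (∀ ξ : ℂ, ‖ξ‖ ≤ 1 →
          conformalInv D' ξ ∈ D ∧ ‖conformalMap D (conformalInv D' ξ) - ξ‖ ≤ η) ∧
        (∀ ξ : ℂ, ∀ z ∈ closure D', ‖z - ξ‖ ≤ δ₀ →
          ξ ∈ D ∧ ‖conformalMap D ξ - conformalMap D z‖ ≤ η) := by
  obtain ⟨M, -, hM⟩ := hB_bdd.exists_pos_norm_lt
  -- One small number `κ` serves as the distance of the level `ρ` to the boundary and as the
  -- tolerance for points of the disc; `8 κ ≤ ε, η` covers all the estimates below.
  obtain ⟨κ, hκ, hκ1, hκε, hκη⟩ : ∃ κ > 0, κ < 1 ∧ 8 * κ ≤ ε ∧ 8 * κ ≤ η := by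
    refine ⟨min (min ε η) 1 / 8, by positivity, ?_, ?_, ?_⟩
    · linarith [min_le_right (min ε η) 1]
    · linarith [(min_le_left (min ε η) 1).trans (min_le_left ε η)]
    · linarith [(min_le_left (min ε η) 1).trans (min_le_right ε η)]
  set ρ := 1 - κ with hρ
  have hρ0 : 0 < ρ := by linarith
  have hρ1 : ρ < 1 := by linarith
  set inv : Set ℂ → ℂ → ℂ := fun D ↦ invFunOn (conformalMap D) D
  have hconf := fun D (hD : D ∈ domainClass B) ↦ isNormalizedConformal_of_mem_domainClass hB_bdd hD
  have hbound : ∀ D ∈ domainClass B, ∀ w ∈ ball (0 : ℂ) 1, ‖inv D w‖ ≤ M := fun D hD w hw ↦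
    (hM _ (hD.1 ((hconf D hD).mapsTo_inv hw))).le
  obtain ⟨τ, hτ, hcov⟩ := exists_uniform_ball_subset_image (c := 1 / 2) (M := M) one_half_pos hρ1 hκ
  -- In terms of `φ_D`: points within `τ` of `φ_D⁻¹ w` lie in `D` and are mapped within `κ` of `w`.
  replace hcov : ∀ D ∈ domainClass B, ∀ w ∈ closedBall (0 : ℂ) ρ, ∀ y, dist y (inv D w) < τ →
      y ∈ D ∧ dist (conformalMap D y) w < κ ∧ inv D (conformalMap D y) = y := by
    intro D hD w hw y hy
    have hc := hconf D hD
    have h0 := ball_subset_of_mem_domainClass hD (mem_ball_self (by norm_num))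
    obtain ⟨x, ⟨hx, hx1⟩, rfl⟩ := hcov (inv D) (hc.differentiableOn_inv hD.2.1.1) hc.injOn_inv
      (hbound D hD) (by
        have := hc.norm_deriv_le_inv_of_ball_subset one_half_pos (ball_subset_of_mem_domainClass hD)
        rw [(hc.hasDerivAt_inv hD.2.1.1 h0).deriv, norm_inv]
        exact (le_inv_comm₀ one_half_pos (norm_pos_iff.2 hc.deriv_ne_zero)).2 this) w hw hy
    have hx' : conformalMap D (inv D x) = x := hc.apply_inv hx1
    exact ⟨hc.mapsTo_inv hx1, by rwa [hx'], by rw [hx']⟩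
  obtain ⟨T, hTS, hTfin, hT⟩ := exists_finite_net_of_bounded (S := inv '' domainClass B) (M := M)
    isOpen_ball (isCompact_closedBall (0 : ℂ) ρ) (closedBall_subset_ball hρ1)
    (by rintro _ ⟨D, hD, rfl⟩; exact (hconf D hD).differentiableOn_inv hD.2.1.1)
    (by rintro _ ⟨D, hD, rfl⟩; exact hbound D hD) (half_pos hτ)
  refine ⟨τ / 2, half_pos hτ, (fun f ↦ f '' ball 0 ρ) '' T, hTfin.image _, ?_, ?_⟩
  · rintro _ ⟨f, hf, rfl⟩
    obtain ⟨E, hE, rfl⟩ := hTS hf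
    have hc := hconf E hE
    have hEo := hE.2.1.1
    have h0 := ball_subset_of_mem_domainClass hE (mem_ball_self (by norm_num))
    have hsc := hc.isSimplyConnected_image_ball hEo hρ0 hρ1
    exact ⟨⟨hc.isOpen_image_ball hEo hρ1, hsc.isPathConnected.isConnected⟩, hsc,
      hc.zero_mem_image_ball h0 hρ0, (hc.image_ball_subset hρ1).trans hE.1,
      hc.continuousOn_conformalInv_image_ball hEo h0 hρ0 hρ1⟩
  intro D hD
  -- `E` is the member of the class whose inverse map is close to that of `D`.
  have hcD := hconf D hD
  obtain ⟨f, hf, hclose⟩ := hT _ (mem_image_of_mem inv hD)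
  refine ⟨_, mem_image_of_mem _ hf, ?_⟩
  obtain ⟨E, hE, rfl⟩ := hTS hf
  have hcE := hconf E hE
  have hEo := hE.2.1.1
  have h0E := ball_subset_of_mem_domainClass hE (mem_ball_self (by norm_num))
  have hclosure : closure (inv E '' ball 0 ρ) ⊆ inv E '' closedBall 0 ρ :=
    hcE.closure_image_ball_subset hEo hρ1
  have hDE : ∀ w ∈ closedBall (0 : ℂ) ρ, inv E w ∈ D ∧
      dist (conformalMap D (inv E w)) w < κ := fun w hw ↦
    have h := hcov D hD w hw (inv E w) (by
      rw [dist_comm, dist_eq_norm]; linarith [hclose w hw])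
    ⟨h.1, h.2.1⟩
  have hcl : closure (inv E '' ball 0 ρ) ⊆ D := fun z hz ↦ by
    obtain ⟨w, hw, rfl⟩ := hclosure hz
    exact (hDE w hw).1
  refine ⟨⟨subset_closure.trans hcl, hcl⟩, ?_, ?_, ?_, ?_⟩
  · intro a ha hle
    have hwρ : conformalMap D a ∈ closedBall (0 : ℂ) ρ := by
      rw [mem_closedBall_zero_iff]; linarith
    have hinva : inv D (conformalMap D a) = a := hcD.inv_apply ha
    -- Here the roles of the two domains are exchanged: `a` is close to the image of `φ_D a` in `E`.
    obtain ⟨-, hd, hback⟩ := hcov E hE _ hwρ a (by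
      have := hclose _ hwρ
      rw [hinva] at this
      rw [dist_eq_norm]; linarith)
    have hnorm : ‖conformalMap E a‖ ≤ ρ * (1 - ε / 2) := by
      have h1 := norm_le_norm_add_norm_sub' (conformalMap E a) (conformalMap D a)
      rw [dist_eq_norm] at hd
      have h2 : 0 < κ * ε := by positivity
      rw [hρ]
      linarith
    have hmem : a ∈ inv E '' ball 0 ρ := by
      refine ⟨conformalMap E a, ?_, hback⟩
      rw [mem_ball_zero_iff]
      nlinarith
    refine ⟨hmem, ?_⟩
    rw [hcE.conformalMap_image_ball hEo h0E hρ0 hρ1 hmem, norm_div, Complex.norm_real,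
      Real.norm_of_nonneg hρ0.le, div_le_iff₀ hρ0, mul_comm]
    exact hnorm
  · intro ξ hξ
    obtain ⟨w, hw, rfl⟩ := hcE.frontier_image_ball_subset hEo hρ1 hξ
    have hd := (hDE w (sphere_subset_closedBall hw)).2
    rw [mem_sphere_zero_iff_norm] at hw
    rw [dist_comm, dist_eq_norm] at hd
    have := norm_le_norm_add_norm_sub' w (conformalMap D (inv E w))
    linarith
  · intro ξ hξ
    rw [hcE.conformalInv_image_ball hEo h0E hρ0 hρ1 (mem_closedBall_zero_iff.2 hξ)]
    have hw : (ρ : ℂ) * ξ ∈ closedBall (0 : ℂ) ρ := by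
      rw [mem_closedBall_zero_iff, norm_mul, Complex.norm_real, Real.norm_of_nonneg hρ0.le]
      exact mul_le_of_le_one_right hρ0.le hξ
    obtain ⟨h1, h2⟩ := hDE _ hw
    refine ⟨h1, ?_⟩
    have h3 : ‖(ρ : ℂ) * ξ - ξ‖ ≤ κ := by
      rw [show (ρ : ℂ) * ξ - ξ = ((-κ : ℝ) : ℂ) * ξ by rw [hρ]; push_cast; ring, norm_mul,
        Complex.norm_real, norm_neg, Real.norm_of_nonneg hκ.le]
      exact mul_le_of_le_one_right hκ.le hξ
    have h4 := dist_triangle (conformalMap D (inv E (ρ * ξ))) (ρ * ξ) ξ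
    rw [dist_eq_norm _ ξ, dist_eq_norm _ ξ] at h4
    linarith
  · intro ξ z hz hzξ
    obtain ⟨w, hw, rfl⟩ := hclosure hz
    obtain ⟨h1, h2, -⟩ := hcov D hD w hw ξ (by
      have h3 : dist ξ (inv E w) ≤ τ / 2 := by rwa [dist_comm, dist_eq_norm]
      have h4 := dist_triangle_right ξ (inv D w) (inv E w)
      rw [dist_eq_norm (inv D w)] at h4
      linarith [hclose w hw])
    refine ⟨h1, ?_⟩
    have h3 := dist_triangle_right (conformalMap D ξ) (conformalMap D (inv E w)) w
    rw [dist_eq_norm] at h3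
    linarith [(hDE w hw).2]
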